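/- **Setting.** Let $H_\tau(x)=\tfrac12x^2$ for $|x|\le\tau$ and $H_\tau(x)=\tau|x|-\tfrac12\tau^2$ for $|x|>\tau$, with $\tau>0$ fixed. For each panel size $(N,T)$ we observe $$Y_{it}=l_{0i}^\top f_{0t}+\epsilon_{it},\qquad 1\le i\le N,\ 1\le t\le T,$$ with non-random loadings $l_{0i}\in\mathbb R^r$, random factors $f_{0t}\in\mathbb R^r$ and random errors $\epsilon_{it}$; all of these may depend on $(N,T)$ (triangular arrays), and are defined on one probability space. Limits "$N,T\to\infty$" are joint limits, and "for all large $N,T$" means for all $N\ge n_0,\ T\ge n_0$, for some $n_0$. For $d\in\mathbb N$ and $\mathcal L,\mathcal F\subseteq\mathbb R^d$, let $\Theta^d(\mathcal L,\mathcal F)$ be the set of all $\theta=(l_1,\dots,l_N,f_1,\dots,f_T)$ such that $l_i\in\mathcal L$ and $f_t\in\mathcal F$ for all $i,t$; $\frac1N\sum_{i}l_il_i^\top=I_d$; and $\frac1T\sum_tf_tf_t^\top$ is a diagonal matrix with positive, non-increasing diagonal entries. For $\theta_a,\theta_b$ with vectors of the same length let $$d(\theta_a,\theta_b)=\Big(\frac1{TN}\sum_{t=1}^T\sum_{i=1}^N\big(l_{ai}^\top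 f_{at}-l_{bi}^\top f_{bt}\big)^2\Big)^{1/2}.$$ **Assumption 1.** $\mathcal L_r,\mathcal F_r\subset\mathbb R^r$ are compact (and do not depend on $N,T$). For all large $N,T$, almost surely, the true parameter $\theta_0=(l_{01},\dots,l_{0N},f_{01},\dots,f_{0T})$ lies in $\Theta^r(\mathcal L_r,\mathcal F_r)$. The diagonal entries of $\frac1T\sum_tf_{0t}f_{0t}^\top$ converge almost surely, as $N,T\to\infty$, to constants $\sigma_{01}>\dots>\sigma_{0r}>0$. **Assumption 2.** For every $N,T$, given $\{f_{0t}\}_{t\le T}$, the errors $\epsilon_{it}$ are independent across $i$ and $t$. **Assumption 3.** The conditional distributions of the $\epsilon_{it}$ given $\{f_{0t}\}$ have a common support, which contains an open neighbourhood of $0$; $\mathbb E(\epsilon_{it}^2\mid\{f_{0t}\})<\infty$; and $\epsilon_{it}$ has a conditional density $f_{it}$ given $\{f_{0t}\}$ that is continuous, symmetric about $0$, and such that for every compact $C\subset\mathbb R$ there is a constant $\underline f>0$, depending only on $C$, with $f_{it}(u)>\underline f$ for all $u\in C$ and all $i,t,N,T$. (Statements about conditional distributions hold almost surely.) **Overfitted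 model and estimator.** Let $k>r$ and let $\mathcal L_k,\mathcal F_k\subset\mathbb R^k$ be compact sets, not depending on $N,T$. Let $\theta_0^k$ consist of the zero-padded vectors $(l_{0i}^\top,0)^\top,(f_{0t}^\top,0)^\top\in\mathbb R^k$. Assume that, for all large $N,T$, almost surely, $(l_{0i}^\top,0)^\top\in\mathcal L_k$ and $(f_{0t}^\top,0)^\top\in\mathcal F_k$ for all $i,t$, and that $\theta_0^k$ is a $d$-limit of points of $\Theta^k=\Theta^k(\mathcal L_k,\mathcal F_k)$: for each $\eta>0$ there is $\theta\in\Theta^k$ with $d(\theta,\theta_0^k)<\eta$. Let $\widehat\theta^k=(\widehat l_1^k,\dots,\widehat l_N^k,\widehat f_1^k,\dots,\widehat f_T^k)$ be a random element which, with probability tending to $1$ as $N,T\to\infty$, is a minimizer over $\Theta^k$ of $$\frac1{TN}\sum_{t=1}^T\sum_{i=1}^NH_\tau\big(Y_{it}-l_i^\top f_t\big).$$ For a deterministic threshold $P=P_{N,T}$ let $\widehat r$ be the number of diagonal entries of $\frac1T\sum_{t=1}^T\widehat f_t^k\widehat f_t^{k\top}$ that are greater than $P$. **Theorem.** Under Assumptions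 1–3 and the above conditions, if $P\to0$ and $P\cdot\min\{N,T\}\to\infty$ as $N,T\to\infty$, then $\mathbb P(\widehat r=r)\to1$ as $N,T\to\infty$. -/

import Mathlib

open Filter Topology MeasureTheory ProbabilityTheory

noncomputable section

namespace HuberFactor

/-- Column vectors of length `d`. -/
abbrev Vec (d : ℕ) : Type := EuclideanSpace ℝ (Fin d)

/-- The Huber loss `H_τ`. -/
def huber (τ x : ℝ) : ℝ :=
  if |x| ≤ τ then x ^ 2 / 2 else τ * |x| - τ ^ 2 / 2

/-- A parameter `θ = (l_1, …, l_N, f_1, …, f_T)` with vectors of length `d`: the loadings are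
`θ.1`, the factors are `θ.2`. -/
abbrev Param (d N T : ℕ) : Type := (Fin N → Vec d) × (Fin T → Vec d)

/-- The matrix `(1/n) ∑ₘ vₘ vₘᵀ`. For the rows of `L` it is `Lᵀ L / N`, for the rows of `F` it is
`Fᵀ F / T`. -/
def secondMoment {n d : ℕ} (v : Fin n → Vec d) : Matrix (Fin d) (Fin d) ℝ :=
  Matrix.of fun a b => (∑ m, v m a * v m b) / (n : ℝ)

/-- The parameter space `Θ`: rows in `𝓛` and `𝓕`, `Lᵀ L / N = I`, and `Fᵀ F / T` diagonal with
positive non-increasing diagonal entries. -/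
def paramSpace {d : ℕ} (𝓛 𝓕 : Set (Vec d)) (N T : ℕ) : Set (Param d N T) :=
  {θ | (∀ i, θ.1 i ∈ 𝓛) ∧ (∀ t, θ.2 t ∈ 𝓕) ∧
    secondMoment θ.1 = 1 ∧
    (secondMoment θ.2).IsDiag ∧
    (∀ j, 0 < secondMoment θ.2 j j) ∧
    Antitone fun j => secondMoment θ.2 j j}

/-- The common component `l_iᵀ f_t`. -/
def common {d N T : ℕ} (θ : Param d N T) (i : Fin N) (t : Fin T) : ℝ :=
  inner ℝ (θ.1 i) (θ.2 t)

/-- The element-wise Huber objective `(1/(TN)) ∑ₜ ∑ᵢ H_τ (Y_it - l_iᵀ f_t)`. -/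
def huberObjective {d N T : ℕ} (τ : ℝ) (Y : Fin N → Fin T → ℝ) (θ : Param d N T) : ℝ :=
  (∑ t, ∑ i, huber τ (Y i t - common θ i t)) / ((T : ℝ) * (N : ℝ))

/-- `θ` is a global minimizer of the Huber objective over the parameter space. -/
def IsHuberMinimizer {d N T : ℕ} (τ : ℝ) (𝓛 𝓕 : Set (Vec d)) (Y : Fin N → Fin T → ℝ)
    (θ : Param d N T) : Prop :=
  θ ∈ paramSpace 𝓛 𝓕 N T ∧ IsMinOn (huberObjective τ Y) (paramSpace 𝓛 𝓕 N T) θ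

/-- The pseudo-distance `‖L_a F_aᵀ - L_b F_bᵀ‖_F / √(TN)`. -/
def commonDist {d N T : ℕ} (θa θb : Param d N T) : ℝ :=
  √((∑ t, ∑ i, (common θa i t - common θb i t) ^ 2) / ((T : ℝ) * (N : ℝ)))

/-- The vector `(vᵀ, 0)ᵀ` of length `k`, for `v` of length `r ≤ k`. -/
def padVec {r : ℕ} (k : ℕ) (v : Vec r) : Vec k :=
  WithLp.toLp 2 fun j => if h : (j : ℕ) < r then v ⟨j, h⟩ else 0

/-- The parameter with every loading and factor padded by zeros. -/
def padParam {r N T : ℕ} (k : ℕ) (θ : Param r N T) : Param k N T :=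
  (fun i => padVec k (θ.1 i), fun t => padVec k (θ.2 t))

/-- The number of diagonal entries of `(1/T) ∑ₜ f_t f_tᵀ` that exceed the threshold `P`. -/
def factorCount {k N T : ℕ} (P : ℝ) (θ : Param k N T) : ℕ :=
  (Finset.univ.filter fun j : Fin k => P < secondMoment θ.2 j j).card

/-- The true factor model with `r` factors, for every panel size `(N, T)`. The loadings are
constants; factors and errors are random. All of them form arrays indexed by `(N, T)`, since the
normalization of the true parameter is imposed at each size separately. -/
structure FactorModel (Ω : Type*) [MeasurableSpace Ω] (r : ℕ) where
  loading : ∀ N T : ℕ, Fin N → Vec r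
  factor : ∀ N T : ℕ, Fin T → Ω → Vec r
  error : ∀ N T : ℕ, Fin N → Fin T → Ω → ℝ
  measurable_factor : ∀ N T t, Measurable (factor N T t)
  measurable_error : ∀ N T i t, Measurable (error N T i t)

namespace FactorModel

variable {Ω : Type*} [MeasurableSpace Ω] {r : ℕ}

/-- The true parameter `θ₀`. -/
def trueParam (M : FactorModel Ω r) (N T : ℕ) (ω : Ω) : Param r N T :=
  (M.loading N T, fun t => M.factor N T t ω)

/-- The observations `Y_it = l_0iᵀ f_0t + ε_it`. -/
def obs (M : FactorModel Ω r) (N T : ℕ) (ω : Ω) : Fin N → Fin T → ℝ :=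
  fun i t => common (M.trueParam N T ω) i t + M.error N T i t ω

/-- All the factors `{f_0t}` as one random element. -/
def factors (M : FactorModel Ω r) (N T : ℕ) (ω : Ω) : Fin T → Vec r :=
  fun t => M.factor N T t ω

/-- All the errors `{ε_it}` as one random element. -/
def errors (M : FactorModel Ω r) (N T : ℕ) (ω : Ω) : Fin N → Fin T → ℝ :=
  fun i t => M.error N T i t ω

/-- The strong factor assumption: `𝓛` and `𝓕` are compact, `θ₀ ∈ Θ` for all large `N, T`, and the
diagonal entries of `(1/T) ∑ₜ f_0t f_0tᵀ` converge to constants `σ₀₁ > … > σ₀ᵣ > 0`. -/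
structure StrongFactors (M : FactorModel Ω r) (μ : Measure Ω) (𝓛 𝓕 : Set (Vec r)) : Prop where
  compact_loadings : IsCompact 𝓛
  compact_factors : IsCompact 𝓕
  true_mem : ∀ᶠ p : ℕ × ℕ in atTop, ∀ᵐ ω ∂μ, M.trueParam p.1 p.2 ω ∈ paramSpace 𝓛 𝓕 p.1 p.2
  limits : ∃ σ₀ : Fin r → ℝ, StrictAnti σ₀ ∧ (∀ j, 0 < σ₀ j) ∧
    ∀ j, ∀ᵐ ω ∂μ, Tendsto (fun p : ℕ × ℕ => secondMoment (M.factors p.1 p.2 ω) j j)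
      atTop (𝓝 (σ₀ j))

/-- Given the factors, the errors are independent across `i` and `t`. -/
def CondIndepErrors (M : FactorModel Ω r) (μ : Measure Ω) [IsProbabilityMeasure μ] : Prop :=
  ∀ N T : ℕ, ∀ᵐ x ∂(μ.map (M.factors N T)),
    iIndepFun (fun (q : Fin N × Fin T) (e : Fin N → Fin T → ℝ) => e q.1 q.2)
      (condDistrib (M.errors N T) (M.factors N T) μ x)

/-- The conditional law of `ε_it` given the factors. -/
def errorLaw (M : FactorModel Ω r) (μ : Measure Ω) [IsProbabilityMeasure μ] (N T : ℕ)
    (i : Fin N) (t : Fin T) : Kernel (Fin T → Vec r) ℝ :=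
  condDistrib (M.error N T i t) (M.factors N T) μ

/-- Conditions on the conditional laws of the errors given the factors: a common support that is
a neighbourhood of `0`, finite conditional second moments, and conditional densities that are
continuous, symmetric about `0`, and bounded below by a positive constant on each compact set,
uniformly in `i`, `t` (and the panel size). -/
structure RegularErrors (M : FactorModel Ω r) (μ : Measure Ω) [IsProbabilityMeasure μ] :
    Prop where
  support : ∃ S ∈ 𝓝 (0 : ℝ), ∀ N T i t, ∀ᵐ x ∂(μ.map (M.factors N T)),
    (M.errorLaw μ N T i t x).support = S
  second_moment : ∀ N T i t, ∀ᵐ x ∂(μ.map (M.factors N T)),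
    ∫⁻ u, ENNReal.ofReal (u ^ 2) ∂(M.errorLaw μ N T i t x) < ⊤
  density : ∃ f : ∀ N T : ℕ, Fin N → Fin T → (Fin T → Vec r) → ℝ → ℝ,
    (∀ N T i t, ∀ᵐ x ∂(μ.map (M.factors N T)),
      M.errorLaw μ N T i t x = volume.withDensity (fun u => ENNReal.ofReal (f N T i t x u)) ∧
      Continuous (f N T i t x) ∧
      (∀ u, f N T i t x (-u) = f N T i t x u)) ∧
    ∀ C : Set ℝ, IsCompact C → ∃ c > 0, ∀ N T i t, ∀ᵐ x ∂(μ.map (M.factors N T)),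
      ∀ u ∈ C, c < f N T i t x u

end FactorModel

end HuberFactor

end

/-! With `Lᵀ L / N = I` and `Fᵀ F / T` diagonal, the diagonal entries of `Fᵀ F / T` are the nonzero
squared singular values of `L Fᵀ / √(NT)`. The true matrix has rank `r`, and its entries stay above
some `σ > 0` with probability tending to one. By a Weyl-type perturbation bound
(`sqrt_le_sqrt_add_commonDist`), the count above `P` is exactly `r` once the distance between fitted
and true common components is below `√P` and `4P < σ`. It remains to show that this distance is of
order `1 / √(min N T)`.

Let `D` be the difference of common components, a sum of `k + r` rank-one matrices with entries
bounded by some `B`. The objective is Lipschitz in the pseudo-distance, so being a limit of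
admissible parameters suffices for the padded truth to be beaten: `∑ H(e - D) ≤ ∑ H(e)`. By local
strong convexity (`huber_sub_ge`), `H(e - δ)` exceeds its tangent line by a multiple of `δ²`
whenever `|e| ≤ τ/2`. Replacing that indicator by its conditional mean, which is at least some `c >
0`, leaves two noise matrices with bounded entries, conditionally independent and centred: `clip τ
e`, paired with `D`, and the centred indicator, paired with the entrywise square of `D`.

Both `D` and its entrywise square have bounded rank, so each pairing is at most a constant times
operator norm times `‖D‖_F` (`BilinearBound.sum_mul_le`). This gives `‖D‖_F² ≲ A ‖D‖_F` with `A` a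
bound on both operator norms, with no preliminary consistency step. A net and Hoeffding's
inequality, applied conditionally on the factors, give `A` of order `√(N + T)` outside an event of
probability `exp(-(N + T))` for each matrix (`measure_not_bilinearBound_le`). Division by `√(NT)`
yields the rate. -/

noncomputable section

namespace HuberFactor

/-! ### Convexity of the Huber loss. -/

section Huber

/-- The derivative of the Huber loss. -/
def clip (τ x : ℝ) : ℝ := max (-τ) (min τ x)

lemma abs_clip_le {τ : ℝ} (hτ : 0 < τ) (x : ℝ) : |clip τ x| ≤ τ := by
  rw [abs_le]
  exact ⟨le_max_left _ _, max_le (by linarith) (min_le_left _ _)⟩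

lemma measurable_clip (τ : ℝ) : Measurable (clip τ) := by
  unfold clip; fun_prop

lemma clip_neg {τ : ℝ} (hτ : 0 < τ) (x : ℝ) : clip τ (-x) = -clip τ x := by
  unfold clip
  rcases max_cases (-τ) (min τ x) with h | h <;> rcases min_cases τ x with h' | h' <;>
    rcases max_cases (-τ) (min τ (-x)) with g | g <;> rcases min_cases τ (-x) with g' | g' <;>
    linarith

lemma clip_of_abs_le {τ x : ℝ} (h : |x| ≤ τ) : clip τ x = x := by
  obtain ⟨h1, h2⟩ := abs_le.1 h
  rw [clip, min_eq_right h2, max_eq_right h1]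

/-- Legendre duality: the Huber loss dominates its supporting lines. -/
lemma mul_sub_sq_le_huber {τ s : ℝ} (hs : |s| ≤ τ) (y : ℝ) : s * y - s ^ 2 / 2 ≤ huber τ y := by
  unfold huber
  split_ifs with h
  · nlinarith [sq_nonneg (s - y)]
  · push Not at h
    have h1 : s * y ≤ |s| * |y| := (le_abs_self _).trans (abs_mul s y).le
    rw [← sq_abs s]
    nlinarith [abs_nonneg s]

/-- Equality case of the duality: the optimal slope in `[-τ, τ]` is the derivative at `y`. -/
lemma huber_eq_clip {τ : ℝ} (hτ : 0 < τ) (y : ℝ) :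
    huber τ y = clip τ y * y - clip τ y ^ 2 / 2 := by
  unfold huber
  split_ifs with h
  · rw [clip_of_abs_le h]; ring
  · push Not at h
    rcases lt_abs.1 h with h' | h'
    · rw [clip, min_eq_left h'.le, max_eq_right (by linarith), abs_of_pos (by linarith)]
    · rw [clip, min_eq_right (by linarith), max_eq_left (by linarith), abs_of_neg (by linarith)]
      ring

lemma huber_sub_le {τ : ℝ} (hτ : 0 < τ) (x y : ℝ) : huber τ x - huber τ y ≤ τ * |x - y| := by
  have h1 := huber_eq_clip hτ x
  have h2 := mul_sub_sq_le_huber (abs_clip_le hτ x) y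
  have h3 : clip τ x * (x - y) ≤ |clip τ x| * |x - y| :=
    (le_abs_self _).trans (abs_mul _ _).le
  have h4 := mul_le_mul_of_nonneg_right (abs_clip_le hτ x) (abs_nonneg (x - y))
  linarith

/-- Local strong convexity of the Huber loss. -/
lemma huber_sub_ge {τ B : ℝ} (hτ : 0 < τ) (hB : τ ≤ B) (e : ℝ) {δ : ℝ} (hδ : |δ| ≤ B) :
    huber τ e - clip τ e * δ +
      τ / (4 * B) * (Set.indicator (Set.Icc (-(τ / 2)) (τ / 2)) 1 e * δ ^ 2) ≤
      huber τ (e - δ) := by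
  have hB0 : 0 < B := hτ.trans_le hB
  by_cases h : e ∈ Set.Icc (-(τ / 2)) (τ / 2)
  · have he : |e| ≤ τ / 2 := abs_le.2 h
    have h0 : clip τ e = e := clip_of_abs_le (by linarith)
    rw [Set.indicator_of_mem h, huber_eq_clip hτ e, h0]
    -- The supporting slope is `s = e - q δ`. The choice `q B = τ/2` keeps `|s| ≤ τ`, and the line
    -- with this slope gains `(q - q²/2) δ² ≥ (q/2) δ²` over the tangent at `e`.
    set q := τ / (2 * B) with hq
    have hq0 : 0 < q := by positivity
    have hq1 : q ≤ 1 / 2 := by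
      rw [hq, div_le_div_iff₀ (by positivity) (by norm_num)]; linarith
    have hqB : q * B = τ / 2 := by rw [hq]; field_simp
    have hs : |e - q * δ| ≤ τ := by
      calc |e - q * δ| ≤ |e| + |q * δ| := abs_sub _ _
        _ = |e| + q * |δ| := by rw [abs_mul, abs_of_pos hq0]
        _ ≤ τ / 2 + q * B := by gcongr
        _ = τ := by rw [hqB]; ring
    have := mul_sub_sq_le_huber hs (e - δ)
    have h4 : τ / (4 * B) = q / 2 := by rw [hq]; field_simp; norm_num
    rw [h4, Pi.one_apply]
    nlinarith [mul_nonneg (mul_nonneg hq0.le (sub_nonneg.2 hq1)) (sq_nonneg δ),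
      mul_nonneg hq0.le (sq_nonneg δ)]
  · rw [Set.indicator_of_notMem h, huber_eq_clip hτ e]
    have := mul_sub_sq_le_huber (abs_clip_le hτ e) (e - δ)
    linarith

end Huber

/-! ### Operator norm duality and the basic inequality. -/

section BilinearBound

variable {N T : ℕ}

/-- The bilinear form of the matrix `W` is bounded by `C` in operator norm. -/
def BilinearBound (W : Fin N → Fin T → ℝ) (C : ℝ) : Prop :=
  ∀ (x : Vec N) (y : Vec T), ∑ t, ∑ i, W i t * x i * y t ≤ C * ‖x‖ * ‖y‖

lemma BilinearBound.neg {W : Fin N → Fin T → ℝ} {C : ℝ} (h : BilinearBound W C) :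
    BilinearBound (fun i t => -W i t) C := by
  intro x y
  have := h (-x) y
  simpa [norm_neg] using this

/-- Duality between operator and nuclear norms for matrices of bounded rank. -/
lemma BilinearBound.sum_mul_le {W : Fin N → Fin T → ℝ} {C : ℝ} (hW : BilinearBound W C)
    (hC : 0 ≤ C) {ι : Type*} [Fintype ι] (u : ι → Fin N → ℝ) (v : ι → Fin T → ℝ)
    (D : Fin N → Fin T → ℝ) (hD : ∀ i t, D i t = ∑ j, u j i * v j t) :
    ∑ t, ∑ i, W i t * D i t ≤ C * √(Fintype.card ι) * √(∑ t, ∑ i, D i t ^ 2) := by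
  let U : ι → Vec N := fun j => WithLp.toLp 2 (u j)
  let V : Submodule ℝ (Vec N) := Submodule.span ℝ (Set.range U)
  have hmem : ∀ t, (WithLp.toLp 2 fun i => D i t : Vec N) ∈ V := by
    intro t
    have : (WithLp.toLp 2 fun i => D i t : Vec N) = ∑ j, v j t • U j := by
      ext i
      simp [U, hD, mul_comm]
    rw [this]
    exact Submodule.sum_mem _ fun j _ =>
      Submodule.smul_mem _ _ (Submodule.subset_span (Set.mem_range_self j))
  let d : Fin T → V := fun t => ⟨_, hmem t⟩
  -- In an orthonormal basis of the column span, `D = ∑ b_a y_aᵀ` with at most `card ι` terms and,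
  -- by Parseval, `∑ ‖y_a‖² = ‖D‖_F²`. The operator bound applies to each term, and Cauchy–Schwarz
  -- over `a` produces the square root of the rank.
  let b := stdOrthonormalBasis ℝ V
  let y : Fin (Module.finrank ℝ V) → Vec T := fun a => WithLp.toLp 2 fun t => inner ℝ (b a) (d t)
  have hDexp : ∀ i t, D i t = ∑ a, y a t * (b a : Vec N) i := by
    intro i t
    have h := congrArg (fun z : V => (z : Vec N) i) (b.sum_repr' (d t))
    simp only [Submodule.coe_sum, Submodule.coe_smul, WithLp.ofLp_sum, Finset.sum_apply,
      PiLp.smul_apply, smul_eq_mul] at h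
    exact h.symm
  have hnorm : ∑ a, ‖y a‖ ^ 2 = ∑ t, ∑ i, D i t ^ 2 := by
    simp only [EuclideanSpace.real_norm_sq_eq]
    rw [Finset.sum_comm]
    refine Finset.sum_congr rfl fun t _ => ?_
    have h := b.sum_sq_norm_inner_right (d t)
    simp only [Real.norm_eq_abs, sq_abs] at h
    rw [show ‖d t‖ = ‖(d t : Vec N)‖ from rfl, EuclideanSpace.real_norm_sq_eq] at h
    exact h
  have hcard : (Module.finrank ℝ V : ℝ) ≤ Fintype.card ι := by
    exact_mod_cast finrank_range_le_card U
  have hsum : ∑ a, ‖y a‖ ≤ √(Fintype.card ι) * √(∑ t, ∑ i, D i t ^ 2) := by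
    rw [← Real.sqrt_mul (by positivity)]
    apply Real.le_sqrt_of_sq_le
    have := sq_sum_le_card_mul_sum_sq (s := Finset.univ) (f := fun a => ‖y a‖)
    rw [hnorm, Finset.card_univ, Fintype.card_fin] at this
    exact this.trans (mul_le_mul_of_nonneg_right hcard (by positivity))
  calc ∑ t, ∑ i, W i t * D i t
      = ∑ a, ∑ t, ∑ i, W i t * (b a : Vec N) i * y a t := by
        conv_rhs => rw [Finset.sum_comm]
        refine Finset.sum_congr rfl fun t _ => ?_
        conv_rhs => rw [Finset.sum_comm]
        refine Finset.sum_congr rfl fun i _ => ?_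
        rw [hDexp, Finset.mul_sum]
        exact Finset.sum_congr rfl fun a _ => by ring
    _ ≤ ∑ a, C * ‖y a‖ := by
        refine Finset.sum_le_sum fun a _ => ?_
        have h1 : ‖(b a : Vec N)‖ = 1 := b.orthonormal.1 a
        have := hW (b a : Vec N) (y a)
        rwa [h1, mul_one] at this
    _ ≤ C * (√(Fintype.card ι) * √(∑ t, ∑ i, D i t ^ 2)) := by
        rw [← Finset.mul_sum]; gcongr
    _ = _ := by ring

/-- The basic inequality: a perturbation of bounded rank that does not increase the Huber loss is
small in Frobenius norm. -/
lemma frobenius_le_of_huber_le {ι : Type*} [Fintype ι] {τ B c A : ℝ} (hτ : 0 < τ) (hB : τ ≤ B)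
    (hc : 0 < c) (hA : 0 ≤ A) (e D p : Fin N → Fin T → ℝ) (u : ι → Fin N → ℝ)
    (v : ι → Fin T → ℝ) (hD : ∀ i t, D i t = ∑ j, u j i * v j t) (hDB : ∀ i t, |D i t| ≤ B)
    (hp : ∀ i t, c ≤ p i t)
    (hψ : BilinearBound (fun i t => clip τ (e i t)) A)
    (hξ : BilinearBound
      (fun i t => Set.indicator (Set.Icc (-(τ / 2)) (τ / 2)) 1 (e i t) - p i t) A)
    (hle : ∑ t, ∑ i, huber τ (e i t - D i t) ≤ ∑ t, ∑ i, huber τ (e i t)) :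
    √(∑ t, ∑ i, D i t ^ 2) ≤
      (√(Fintype.card ι) + τ / 4 * Fintype.card ι) / (τ / (4 * B) * c) * A := by
  have hB0 : 0 < B := hτ.trans_le hB
  set S := √(∑ t, ∑ i, D i t ^ 2) with hS
  have hS2 : S ^ 2 = ∑ t, ∑ i, D i t ^ 2 := Real.sq_sqrt (by positivity)
  have hS0 : 0 ≤ S := Real.sqrt_nonneg _
  set K : ℝ := ((Fintype.card ι : ℕ) : ℝ) with hK
  have h1 := hψ.sum_mul_le hA u v D hD
  -- The entrywise square of `D` is a sum of `K²` rank-one terms built from products of pairs, so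
  -- its rank factor is `√(K²) = K`.
  have h2 := hξ.neg.sum_mul_le hA (ι := ι × ι) (fun q i => u q.1 i * u q.2 i)
    (fun q t => v q.1 t * v q.2 t) (fun i t => D i t ^ 2) (by
      intro i t
      rw [sq, hD, Finset.sum_mul_sum, ← Finset.univ_product_univ, Finset.sum_product]
      exact Finset.sum_congr rfl fun _ _ => Finset.sum_congr rfl fun _ _ => by ring)
  have hcard : √((Fintype.card (ι × ι) : ℕ) : ℝ) = K := by
    rw [Fintype.card_prod, Nat.cast_mul, Real.sqrt_mul_self (by positivity)]
  -- Boundedness of the entries brings the Frobenius norm of the entrywise square back to first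
  -- order in `S`.
  have h4 : √(∑ t, ∑ i, (D i t ^ 2) ^ 2) ≤ B * S := by
    rw [hS, ← Real.sqrt_sq hB0.le, ← Real.sqrt_mul (by positivity)]
    apply Real.sqrt_le_sqrt
    rw [Finset.mul_sum]
    refine Finset.sum_le_sum fun t _ => ?_
    rw [Finset.mul_sum]
    refine Finset.sum_le_sum fun i _ => ?_
    rw [sq (D i t ^ 2)]
    refine mul_le_mul_of_nonneg_right ?_ (sq_nonneg _)
    exact sq_le_sq' (neg_le_of_abs_le (hDB i t)) (le_of_abs_le (hDB i t))
  rw [hcard] at h2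
  have h2' := h2.trans (mul_le_mul_of_nonneg_left h4 (by positivity : 0 ≤ A * K))
  set g := τ / (4 * B) with hg
  have hg0 : 0 < g := by positivity
  have hgB : g * B = τ / 4 := by rw [hg]; field_simp
  have hsum : ∑ t, ∑ i, (huber τ (e i t) - clip τ (e i t) * D i t + g * (c * D i t ^ 2) -
      g * (-(Set.indicator (Set.Icc (-(τ / 2)) (τ / 2)) 1 (e i t) - p i t) * D i t ^ 2)) ≤
      ∑ t, ∑ i, huber τ (e i t - D i t) := by
    refine Finset.sum_le_sum fun t _ => Finset.sum_le_sum fun i _ => ?_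
    refine le_trans ?_ (huber_sub_ge hτ hB (e i t) (hDB i t))
    have := mul_nonneg hg0.le (mul_nonneg (sub_nonneg.2 (hp i t)) (sq_nonneg (D i t)))
    linarith
  simp only [Finset.sum_sub_distrib, Finset.sum_add_distrib, ← Finset.mul_sum] at hsum
  rw [← hS2] at hsum
  -- Curvature against noise: quadratic in `S` on the left, linear on the right. The bound follows
  -- on cancelling `S`, with `S = 0` treated apart.
  have key : g * c * S * S ≤ (√K + τ / 4 * K) * A * S := by
    have := mul_le_mul_of_nonneg_left h2' hg0.le
    have h5 : g * (A * K * (B * S)) = τ / 4 * K * A * S := by rw [← hgB]; ring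
    rw [h5] at this
    nlinarith
  rw [div_mul_eq_mul_div, le_div_iff₀ (by positivity)]
  rcases hS0.eq_or_lt with h0 | h0
  · rw [← h0]; simp; positivity
  · linarith [le_of_mul_le_mul_right key h0]

end BilinearBound

/-! ### Singular value perturbation and the factor count. -/

section Spectral

variable {N T a b : ℕ}

lemma sum_mul_eq_of_secondMoment_eq_one {d n : ℕ} (hn : n ≠ 0) {L : Fin n → Vec d}
    (h : secondMoment L = 1) (j l : Fin d) :
    ∑ i, L i j * L i l = if j = l then (n : ℝ) else 0 := by
  have := congrFun (congrFun h j) l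
  rw [secondMoment, Matrix.of_apply, Matrix.one_apply, div_eq_iff (by positivity)] at this
  rw [this]; split_ifs <;> simp

lemma sum_mul_eq_of_isDiag {d n : ℕ} (hn : n ≠ 0) {F : Fin n → Vec d}
    (h : (secondMoment F).IsDiag) (j l : Fin d) :
    ∑ i, F i j * F i l = if j = l then (n : ℝ) * secondMoment F j j else 0 := by
  split_ifs with hjl
  · subst hjl
    rw [secondMoment, Matrix.of_apply]
    field_simp
  · have := h hjl
    rw [secondMoment, Matrix.of_apply, div_eq_iff (by positivity), zero_mul] at this
    exact this

lemma sum_sq_of_orthogonal {d n : ℕ} (F : Fin n → Vec d) (s : Fin d → ℝ)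
    (h : ∀ j l, ∑ i, F i j * F i l = if j = l then s j else 0) (c : Fin d → ℝ) :
    ∑ i, (∑ j, c j * F i j) ^ 2 = ∑ j, c j ^ 2 * s j := by
  calc ∑ i, (∑ j, c j * F i j) ^ 2
      = ∑ i, ∑ j, ∑ l, c j * c l * (F i j * F i l) := by
        refine Finset.sum_congr rfl fun i _ => ?_
        rw [sq, Finset.sum_mul_sum]
        exact Finset.sum_congr rfl fun _ _ => Finset.sum_congr rfl fun _ _ => by ring
    _ = ∑ j, ∑ l, c j * c l * ∑ i, F i j * F i l := by
        rw [Finset.sum_comm]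
        refine Finset.sum_congr rfl fun j _ => ?_
        rw [Finset.sum_comm]
        exact Finset.sum_congr rfl fun l _ => by rw [Finset.mul_sum]
    _ = _ := by
        refine Finset.sum_congr rfl fun j _ => ?_
        simp only [h, mul_ite, mul_zero, Finset.sum_ite_eq, Finset.mem_univ, if_true]
        ring

lemma common_eq_sum {d : ℕ} (θ : Param d N T) (i : Fin N) (t : Fin T) :
    common θ i t = ∑ j, θ.1 i j * θ.2 t j := by
  simp [common, PiLp.inner_apply, mul_comm]

/-- Orthogonality to the columns in `u` imposes fewer linear equations than there are coefficients
supported on `s`, so a nonzero solution exists and can be normalized. -/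
lemma exists_unit_combination (L : Fin N → Vec a) (L' : Fin N → Vec b) (s : Finset (Fin a))
    (u : Finset (Fin b)) (hus : u.card < s.card) :
    ∃ c : Fin a → ℝ, (∀ j ∉ s, c j = 0) ∧ ∑ j, c j ^ 2 = 1 ∧
      ∀ l ∈ u, ∑ i, (∑ j, c j * L i j) * L' i l = 0 := by
  let f : (s → ℝ) →ₗ[ℝ] (u → ℝ) := Matrix.mulVecLin
    (Matrix.of fun (l : u) (j : s) => ∑ i, L i j * L' i l)
  obtain ⟨z, hz, hz0⟩ := Submodule.exists_mem_ne_zero_of_ne_bot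
    (LinearMap.ker_ne_bot_of_finrank_lt (f := f) (by simpa using hus))
  let z' : Fin a → ℝ := fun j => if h : j ∈ s then z ⟨j, h⟩ else 0
  have hz'0 : 0 < ∑ j, z' j ^ 2 := by
    obtain ⟨j, hj⟩ := Function.ne_iff.1 hz0
    refine Finset.sum_pos' (fun _ _ => sq_nonneg _) ⟨j, Finset.mem_univ _, ?_⟩
    have : z' j = z j := by simp [z']
    rw [this]
    have hj' : z j ≠ 0 := hj
    positivity
  set R := √(∑ j, z' j ^ 2) with hR
  have hR2 : R ^ 2 = ∑ j, z' j ^ 2 := Real.sq_sqrt hz'0.le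
  refine ⟨fun j => z' j / R, fun j hj => by simp [z', hj], ?_, fun l hl => ?_⟩
  · simp only [div_pow, ← Finset.sum_div, ← hR2]
    exact div_self (by rw [hR2]; exact hz'0.ne')
  · have h1 : ∑ j : s, (∑ i, L i j * L' i l) * z j = 0 := by
      have := congrFun (LinearMap.mem_ker.1 hz) ⟨l, hl⟩
      simpa [f, Matrix.mulVec, dotProduct] using this
    have h2 : ∑ j, (∑ i, L i j * L' i l) * z' j = 0 := by
      rw [← h1, ← Finset.sum_subset (Finset.subset_univ s), ← Finset.sum_coe_sort s]
      · exact Finset.sum_congr rfl fun j _ => by simp [z']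
      · intro j _ hj; simp [z', hj]
    calc ∑ i, (∑ j, z' j / R * L i j) * L' i l
        = ∑ j, ((∑ i, L i j * L' i l) * z' j) / R := by
          simp only [Finset.sum_mul, Finset.sum_div]
          rw [Finset.sum_comm]
          exact Finset.sum_congr rfl fun _ _ => Finset.sum_congr rfl fun _ _ => by ring
      _ = 0 := by rw [← Finset.sum_div, h2, zero_div]

/-- A Courant–Fischer comparison of the singular values of two normalized common components. -/
lemma sqrt_le_sqrt_add_commonDist (hN : N ≠ 0) (hT : T ≠ 0) (θ : Param a N T) (θ' : Param b N T)
    (hL : secondMoment θ.1 = 1) (hF : (secondMoment θ.2).IsDiag)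
    (hL' : secondMoment θ'.1 = 1) (hF' : (secondMoment θ'.2).IsDiag)
    (s : Finset (Fin a)) (u : Finset (Fin b)) (hus : u.card < s.card) {α β : ℝ}
    (hβ : 0 ≤ β) (hs : ∀ j ∈ s, α ≤ secondMoment θ.2 j j)
    (hu : ∀ j ∉ u, secondMoment θ'.2 j j ≤ β) :
    √α ≤ √β + √((∑ t, ∑ i, (common θ i t - common θ' i t) ^ 2) / ((T : ℝ) * N)) := by
  obtain ⟨c, hc0, hc1, hcu⟩ := exists_unit_combination θ.1 θ'.1 s u hus
  have hN0 : (0 : ℝ) < N := by positivity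
  have hT0 : (0 : ℝ) < T := by positivity
  set x : Fin N → ℝ := fun i => ∑ j, c j * θ.1 i j with hx
  have hx2 : ∑ i, x i ^ 2 = N := by
    rw [hx, sum_sq_of_orthogonal θ.1 (fun _ => N) (sum_mul_eq_of_secondMoment_eq_one hN hL),
      ← Finset.sum_mul, hc1, one_mul]
  set g : Fin b → ℝ := fun l => ∑ i, x i * θ'.1 i l with hg
  -- Bessel's inequality: the columns of `θ'.1` are orthogonal with squared norm `N`, as is that of
  -- `x`. It comes from expanding `‖N x - L' g‖² ≥ 0`.
  have hg2 : ∑ l, g l ^ 2 ≤ N ^ 2 := by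
    have h1 : ∑ i, (∑ l, g l * θ'.1 i l) ^ 2 = (∑ l, g l ^ 2) * N := by
      rw [sum_sq_of_orthogonal θ'.1 (fun _ => N) (sum_mul_eq_of_secondMoment_eq_one hN hL'),
        ← Finset.sum_mul]
    have h2 : ∑ i, x i * ∑ l, g l * θ'.1 i l = ∑ l, g l ^ 2 := by
      simp only [Finset.mul_sum]
      rw [Finset.sum_comm]
      refine Finset.sum_congr rfl fun l _ => ?_
      rw [sq]
      nth_rw 3 [hg]
      rw [Finset.mul_sum]
      exact Finset.sum_congr rfl fun _ _ => by ring
    have h3 : 0 ≤ ∑ i, (N * x i - ∑ l, g l * θ'.1 i l) ^ 2 := by positivity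
    have h4 : ∑ i, (N * x i - ∑ l, g l * θ'.1 i l) ^ 2 =
        N ^ 2 * ∑ i, x i ^ 2 - 2 * N * (∑ i, x i * ∑ l, g l * θ'.1 i l) +
          ∑ i, (∑ l, g l * θ'.1 i l) ^ 2 := by
      rw [Finset.mul_sum, Finset.mul_sum, ← Finset.sum_sub_distrib, ← Finset.sum_add_distrib]
      exact Finset.sum_congr rfl fun _ _ => by ring
    rw [h4, hx2, h2, h1] at h3
    have : (∑ l, g l ^ 2) * N ≤ N ^ 2 * N := by linarith
    exact le_of_mul_le_mul_right this hN0
  have hA : ∀ t, ∑ i, x i * common θ i t = N * ∑ j, c j * θ.2 t j := by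
    intro t
    simp only [common_eq_sum, Finset.mul_sum]
    rw [Finset.sum_comm]
    refine Finset.sum_congr rfl fun j _ => ?_
    have h1 : ∑ i, x i * θ.1 i j = N * c j := by
      simp only [hx, Finset.sum_mul, mul_assoc]
      rw [Finset.sum_comm]
      simp only [← Finset.mul_sum, sum_mul_eq_of_secondMoment_eq_one hN hL]
      simp [mul_comm]
    calc ∑ i, x i * (θ.1 i j * θ.2 t j) = (∑ i, x i * θ.1 i j) * θ.2 t j := by
          rw [Finset.sum_mul]; exact Finset.sum_congr rfl fun _ _ => by ring
      _ = _ := by rw [h1]; ring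
  have hA' : ∀ t, ∑ i, x i * common θ' i t = ∑ l, g l * θ'.2 t l := by
    intro t
    simp only [common_eq_sum, Finset.mul_sum, hg, Finset.sum_mul]
    rw [Finset.sum_comm]
    exact Finset.sum_congr rfl fun _ _ => Finset.sum_congr rfl fun _ _ => by ring
  -- Both matrices are tested on `x`. Then `y` only involves entries in `s`, all at least `α`, while
  -- `y'` only involves entries outside `u`, all at most `β`. The triangle inequality, divided by
  -- `√(N² T)`, is the claim.
  let y : Vec T := WithLp.toLp 2 fun t => ∑ i, x i * common θ i t
  let y' : Vec T := WithLp.toLp 2 fun t => ∑ i, x i * common θ' i t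
  set Q := (∑ t, ∑ i, (common θ i t - common θ' i t) ^ 2) / ((T : ℝ) * N) with hQ
  have hy : (N : ℝ) ^ 2 * T * α ≤ ‖y‖ ^ 2 := by
    rw [EuclideanSpace.real_norm_sq_eq]
    simp only [y, hA, mul_pow]
    rw [← Finset.mul_sum, sum_sq_of_orthogonal θ.2 _ (sum_mul_eq_of_isDiag hT hF), mul_assoc]
    gcongr
    calc (T : ℝ) * α = ∑ j, c j ^ 2 * (T * α) := by rw [← Finset.sum_mul, hc1, one_mul]
      _ ≤ _ := by
        refine Finset.sum_le_sum fun j _ => ?_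
        by_cases hj : j ∈ s
        · have := hs j hj
          gcongr
        · simp [hc0 j hj]
  have hy' : ‖y'‖ ^ 2 ≤ (N : ℝ) ^ 2 * T * β := by
    rw [EuclideanSpace.real_norm_sq_eq]
    simp only [y', hA']
    rw [sum_sq_of_orthogonal θ'.2 _ (sum_mul_eq_of_isDiag hT hF')]
    calc ∑ l, g l ^ 2 * (T * secondMoment θ'.2 l l) ≤ ∑ l, g l ^ 2 * (T * β) := by
          refine Finset.sum_le_sum fun l _ => ?_
          by_cases hl : l ∈ u
          · have : g l = 0 := hcu l hl
            simp [this]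
          · have := hu l hl
            gcongr
      _ ≤ N ^ 2 * (T * β) := by rw [← Finset.sum_mul]; gcongr
      _ = _ := by ring
  have hyy : ‖y - y'‖ ^ 2 ≤ (N : ℝ) ^ 2 * T * Q := by
    rw [EuclideanSpace.real_norm_sq_eq]
    calc ∑ t, (y - y') t ^ 2 = ∑ t, (∑ i, x i * (common θ i t - common θ' i t)) ^ 2 := by
          refine Finset.sum_congr rfl fun t _ => ?_
          simp [y, y', mul_sub, Finset.sum_sub_distrib]
      _ ≤ ∑ t, N * ∑ i, (common θ i t - common θ' i t) ^ 2 := by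
          refine Finset.sum_le_sum fun t _ => ?_
          rw [← hx2]
          exact Finset.sum_mul_sq_le_sq_mul_sq _ _ _
      _ = _ := by rw [← Finset.mul_sum, hQ]; field_simp
  have hm : (0 : ℝ) < N ^ 2 * T := by positivity
  have h1 : √((N : ℝ) ^ 2 * T) * √α ≤ ‖y‖ := by
    rw [← Real.sqrt_mul hm.le]
    exact Real.sqrt_le_iff.2 ⟨norm_nonneg _, hy⟩
  have h2 : ‖y'‖ ≤ √((N : ℝ) ^ 2 * T) * √β := by
    rw [← Real.sqrt_mul hm.le]; exact Real.le_sqrt_of_sq_le hy'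
  have h3 : ‖y - y'‖ ≤ √((N : ℝ) ^ 2 * T) * √Q := by
    rw [← Real.sqrt_mul hm.le]; exact Real.le_sqrt_of_sq_le hyy
  have h4 : ‖y‖ ≤ ‖y'‖ + ‖y - y'‖ := by
    have := norm_add_le y' (y - y'); simpa using this
  refine le_of_mul_le_mul_left ?_ (Real.sqrt_pos.2 hm)
  rw [mul_add]
  linarith

/-- The number of squared singular values above `P` is the true one when the common components are
close. -/
lemma factorCount_eq_of_close (hN : N ≠ 0) (hT : T ≠ 0) {r k : ℕ} (θ₀ : Param r N T)
    (θ : Param k N T)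
    (hL₀ : secondMoment θ₀.1 = 1) (hF₀ : (secondMoment θ₀.2).IsDiag)
    (hL : secondMoment θ.1 = 1) (hF : (secondMoment θ.2).IsDiag)
    {σ P : ℝ} (hP : 0 ≤ P) (hσ : ∀ j, σ ≤ secondMoment θ₀.2 j j)
    (h1 : √((∑ t, ∑ i, (common θ i t - common θ₀ i t) ^ 2) / ((T : ℝ) * N)) < √P)
    (h2 : √P + √((∑ t, ∑ i, (common θ i t - common θ₀ i t) ^ 2) / ((T : ℝ) * N)) < √σ) :
    factorCount P θ = r := by
  rcases lt_trichotomy (factorCount P θ) r with h | h | h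
  · exfalso
    -- Too few: all `r` true directions against the selected ones would force `√σ ≤ √P + d`, with
    -- `d` the distance.
    have := sqrt_le_sqrt_add_commonDist hN hT θ₀ θ hL₀ hF₀ hL hF Finset.univ
      (Finset.univ.filter fun j : Fin k => P < secondMoment θ.2 j j)
      (by simpa [factorCount] using h) hP (fun j _ => hσ j)
      (fun j hj => by simpa using hj)
    simp only [sub_sq_comm (common θ₀ _ _)] at this
    linarith
  · exact h
  · exfalso
    -- Too many: the truth has only `r` directions, so `β = 0` is allowed and `√P ≤ d` would follow.
    have := sqrt_le_sqrt_add_commonDist hN hT θ θ₀ hL hF hL₀ hF₀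
      (Finset.univ.filter fun j : Fin k => P < secondMoment θ.2 j j) Finset.univ
      (by simpa [factorCount] using h) le_rfl
      (fun j hj => (by simpa using hj : P < _).le) (fun j hj => absurd (Finset.mem_univ j) hj)
    rw [Real.sqrt_zero, zero_add] at this
    linarith

end Spectral

/-! ### From the minimizer to a Frobenius bound. -/

section Minimizer

variable {N T : ℕ}

lemma common_padParam {r k : ℕ} (hk : r ≤ k) (θ : Param r N T) (i : Fin N) (t : Fin T) :
    common (padParam k θ) i t = common θ i t := by
  simp only [common_eq_sum, padParam, padVec]
  symm
  refine Finset.sum_of_injOn (Fin.castLE hk) (Fin.castLE_injective hk).injOn (by simp) ?_ ?_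
  · intro j _ hj
    have : ¬ (j : ℕ) < r := fun h => hj ⟨⟨j, h⟩, by simp, rfl⟩
    simp [this]
  · intro j _
    simp

/-- The loss is `τ`-Lipschitz, and a mean absolute deviation is at most the root mean square. Empty
panels are trivial, since division by zero gives zero. -/
lemma huberObjective_sub_le {d : ℕ} {τ : ℝ} (hτ : 0 < τ) (Y : Fin N → Fin T → ℝ)
    (θ θ' : Param d N T) :
    huberObjective τ Y θ - huberObjective τ Y θ' ≤ τ * commonDist θ θ' := by
  rcases Nat.eq_zero_or_pos N with rfl | hN
  · simp [huberObjective, commonDist]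
  rcases Nat.eq_zero_or_pos T with rfl | hT
  · simp [huberObjective, commonDist]
  have hm : (0 : ℝ) < T * N := by positivity
  have h1 : huberObjective τ Y θ - huberObjective τ Y θ' ≤
      τ * ((∑ t, ∑ i, |common θ i t - common θ' i t|) / ((T : ℝ) * N)) := by
    unfold huberObjective
    rw [← sub_div, ← mul_div_assoc, Finset.mul_sum, ← Finset.sum_sub_distrib]
    gcongr with t
    rw [← Finset.sum_sub_distrib, Finset.mul_sum]
    gcongr with i
    refine (huber_sub_le hτ _ _).trans_eq ?_
    rw [abs_sub_comm (common θ i t)]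
    congr 2; ring
  refine h1.trans (mul_le_mul_of_nonneg_left ?_ hτ.le)
  apply Real.le_sqrt_of_sq_le
  have h2 := sq_sum_le_card_mul_sum_sq (s := (Finset.univ : Finset (Fin T × Fin N)))
    (f := fun q => |common θ q.2 q.1 - common θ' q.2 q.1|)
  simp only [sq_abs, ← Finset.univ_product_univ, Finset.sum_product, Finset.card_product,
    Finset.card_univ, Fintype.card_fin, Nat.cast_mul] at h2
  rw [div_pow, div_le_div_iff₀ (by positivity) hm]
  nlinarith [mul_le_mul_of_nonneg_right h2 hm.le]

/-- A minimizer does at least as well as any limit point of the parameter space. -/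
lemma IsHuberMinimizer.objective_le {d : ℕ} {τ : ℝ} (hτ : 0 < τ) {𝓛 𝓕 : Set (Vec d)}
    {Y : Fin N → Fin T → ℝ} {θ θ' : Param d N T} (h : IsHuberMinimizer τ 𝓛 𝓕 Y θ)
    (hcl : ∀ η > 0, ∃ θ'' ∈ paramSpace 𝓛 𝓕 N T, commonDist θ'' θ' < η) :
    huberObjective τ Y θ ≤ huberObjective τ Y θ' := by
  refine le_of_forall_pos_le_add fun ε hε => ?_
  obtain ⟨θ'', hm, hd⟩ := hcl (ε / τ) (by positivity)
  have h1 : huberObjective τ Y θ ≤ huberObjective τ Y θ'' := h.2 hm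
  have h2 := huberObjective_sub_le hτ Y θ'' θ'
  have h3 : τ * commonDist θ'' θ' ≤ ε := by
    have := mul_le_mul_of_nonneg_left hd.le hτ.le
    rwa [mul_div_cancel₀ _ hτ.ne'] at this
  linarith

lemma abs_common_le {d : ℕ} {𝓛 𝓕 : Set (Vec d)} {b c : ℝ} (h𝓛 : ∀ x ∈ 𝓛, ‖x‖ ≤ b)
    (h𝓕 : ∀ x ∈ 𝓕, ‖x‖ ≤ c) {θ : Param d N T} (h : θ ∈ paramSpace 𝓛 𝓕 N T)
    (i : Fin N) (t : Fin T) : |common θ i t| ≤ b * c :=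
  (abs_real_inner_le_norm _ _).trans (mul_le_mul (h𝓛 _ (h.1 i)) (h𝓕 _ (h.2.1 t))
    (norm_nonneg _) ((norm_nonneg _).trans (h𝓛 _ (h.1 i))))

/-- The common components of the estimator and of the truth are close in Frobenius norm. -/
lemma frobenius_common_sub_le {r k : ℕ} (hk : r ≤ k) {τ B c A : ℝ} (hτ : 0 < τ) (hB : τ ≤ B)
    (hc : 0 < c) (hA : 0 ≤ A) (hN : N ≠ 0) (hT : T ≠ 0) {𝓛 𝓕 : Set (Vec k)}
    (e p : Fin N → Fin T → ℝ) (θ₀ : Param r N T) (θ : Param k N T)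
    (hmin : IsHuberMinimizer τ 𝓛 𝓕 (fun i t => common θ₀ i t + e i t) θ)
    (hcl : ∀ η > 0, ∃ θ' ∈ paramSpace 𝓛 𝓕 N T, commonDist θ' (padParam k θ₀) < η)
    (hDB : ∀ i t, |common θ i t - common θ₀ i t| ≤ B)
    (hp : ∀ i t, c ≤ p i t)
    (hψ : BilinearBound (fun i t => clip τ (e i t)) A)
    (hξ : BilinearBound
      (fun i t => Set.indicator (Set.Icc (-(τ / 2)) (τ / 2)) 1 (e i t) - p i t) A) :
    √(∑ t, ∑ i, (common θ i t - common θ₀ i t) ^ 2) ≤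
      (√((k + r : ℕ) : ℝ) + τ / 4 * (k + r : ℕ)) / (τ / (4 * B) * c) * A := by
  have := frobenius_le_of_huber_le (ι := Fin k ⊕ Fin r) hτ hB hc hA e
    (fun i t => common θ i t - common θ₀ i t) p
    (Sum.elim (fun j i => θ.1 i j) (fun j i => -θ₀.1 i j))
    (Sum.elim (fun j t => θ.2 t j) (fun j t => θ₀.2 t j))
    (fun i t => by
      simp [common_eq_sum, Fintype.sum_sum_type, Finset.sum_neg_distrib, sub_eq_add_neg])
    hDB hp hψ hξ (by
      have h := hmin.objective_le hτ hcl
      unfold huberObjective at h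
      rw [div_le_div_iff_of_pos_right (by positivity)] at h
      simp only [common_padParam hk] at h
      have h' : ∀ i t, common θ₀ i t + e i t - common θ i t =
          e i t - (common θ i t - common θ₀ i t) := fun i t => by ring
      simpa only [h', add_sub_cancel_left] using h)
  simpa [Fintype.card_sum] using this

end Minimizer

/-! ### Finite nets for operator norms. -/

section Net

/-- A finite set of directions that detects the norm of every vector. -/
def IsNorming {n : ℕ} (s : Finset (Vec n)) : Prop :=
  ∀ (w : Vec n) (a : ℝ), 0 ≤ a → (∀ c ∈ s, inner ℝ w c ≤ a) → ‖w‖ ≤ a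

/-- A maximal `1`-separated subset of the ball of radius `2` works: rescaling `w` to norm `2` and
taking `c` within distance `1` gives `2‖w‖ ≤ ⟪w, c⟫ + ‖w‖`. The ratio of the two radii is what makes
the norming constant exactly `1`. -/
lemma exists_isNorming (n : ℕ) :
    ∃ s : Finset (Vec n), s.card ≤ 5 ^ n ∧ (∀ c ∈ s, ‖c‖ ≤ 2) ∧ IsNorming s := by
  classical
  let Sep : Finset (Vec n) → Prop := fun s =>
    (∀ c ∈ s, ‖c‖ ≤ 2) ∧ ∀ c ∈ s, ∀ d ∈ s, c ≠ d → 1 ≤ ‖c - d‖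
  have hcard : ∀ s, Sep s → s.card ≤ 5 ^ n := fun s hs => by
    simpa using Besicovitch.card_le_of_separated s hs.1 hs.2
  have hbdd : BddAbove {m | ∃ s, Sep s ∧ s.card = m} :=
    ⟨5 ^ n, by rintro _ ⟨s, hs, rfl⟩; exact hcard s hs⟩
  obtain ⟨s, hs, hmax⟩ := Nat.sSup_mem (s := {m | ∃ s, Sep s ∧ s.card = m})
    ⟨0, ∅, by simp [Sep], rfl⟩ hbdd
  refine ⟨s, hcard s hs, hs.1, fun w a ha h => ?_⟩
  rcases eq_or_ne w 0 with rfl | hw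
  · simpa using ha
  have hw0 : 0 < ‖w‖ := norm_pos_iff.2 hw
  set x : Vec n := (2 / ‖w‖) • w with hx
  have hx2 : ‖x‖ = 2 := by
    rw [hx, norm_smul, Real.norm_eq_abs, abs_of_pos (by positivity)]
    field_simp
  have hwx : inner ℝ w x = 2 * ‖w‖ := by
    rw [hx, inner_smul_right, real_inner_self_eq_norm_sq]
    field_simp
  obtain ⟨c, hc, hxc⟩ : ∃ c ∈ s, ‖x - c‖ ≤ 1 := by
    by_contra! hfar
    have hxs : x ∉ s := fun hxs => by
      have := hfar x hxs
      simp at this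
      linarith
    have hsep : Sep (insert x s) := by
      refine ⟨fun c hc => ?_, fun c hc d hd hcd => ?_⟩
      · rcases Finset.mem_insert.1 hc with rfl | hc
        · exact hx2.le
        · exact hs.1 c hc
      · rcases Finset.mem_insert.1 hc with rfl | hc <;> rcases Finset.mem_insert.1 hd with rfl | hd
        · exact absurd rfl hcd
        · exact (hfar d hd).le
        · rw [norm_sub_rev]; exact (hfar c hc).le
        · exact hs.2 c hc d hd hcd
    have h1 := le_csSup hbdd ⟨_, hsep, rfl⟩
    rw [Finset.card_insert_of_notMem hxs] at h1
    omega
  have h1 := h c hc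
  have h2 : inner ℝ w (x - c) ≤ ‖w‖ := (real_inner_le_norm _ _).trans
    (mul_le_of_le_one_right hw0.le hxc)
  rw [inner_sub_right, hwx] at h2
  linarith

/-- Norming is used twice: first over `s`, to bound `‖W y‖` for `y` in the net `u`, then over `u`,
to bound `‖Wᵀ x‖` for every `x`. -/
lemma bilinearBound_of_isNorming {N T : ℕ} {s : Finset (Vec N)} {u : Finset (Vec T)}
    (hs : IsNorming s) (hu : IsNorming u) {W : Fin N → Fin T → ℝ} {a : ℝ} (ha : 0 ≤ a)
    (h : ∀ x ∈ s, ∀ y ∈ u, ∑ t, ∑ i, W i t * x i * y t ≤ a) : BilinearBound W a := by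
  let w : Vec T → Vec N := fun y => WithLp.toLp 2 fun i => ∑ t, W i t * y t
  let v : Vec N → Vec T := fun x => WithLp.toLp 2 fun t => ∑ i, W i t * x i
  have hv : ∀ x y, inner ℝ (v x) y = ∑ t, ∑ i, W i t * x i * y t := by
    intro x y
    simp only [v, PiLp.inner_apply, RCLike.inner_apply, conj_trivial, Finset.mul_sum]
    exact Finset.sum_congr rfl fun _ _ => Finset.sum_congr rfl fun _ _ => by ring
  have hw : ∀ x y, inner ℝ (w y) x = ∑ t, ∑ i, W i t * x i * y t := by
    intro x y
    simp only [w, PiLp.inner_apply, RCLike.inner_apply, conj_trivial, Finset.mul_sum]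
    rw [Finset.sum_comm]
    exact Finset.sum_congr rfl fun _ _ => Finset.sum_congr rfl fun _ _ => by ring
  intro x y
  rw [← hv]
  refine (real_inner_le_norm _ _).trans (mul_le_mul_of_nonneg_right ?_ (norm_nonneg _))
  refine hu _ _ (by positivity) fun y hy => ?_
  rw [hv, ← hw]
  refine (real_inner_le_norm _ _).trans (mul_le_mul_of_nonneg_right ?_ (norm_nonneg _))
  exact hs _ _ ha fun x hx => (hw x y).trans_le (h x hx y hy)

end Net

/-! ### Conditional concentration of random matrices. -/

section Concentration

variable {N T : ℕ}

/-- Hoeffding's inequality for a bilinear form in a matrix with independent centred entries. -/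
lemma measure_bilinear_ge_le {ν : Measure (Fin N → Fin T → ℝ)} [IsProbabilityMeasure ν]
    (hind : iIndepFun (fun (q : Fin N × Fin T) (e : Fin N → Fin T → ℝ) => e q.1 q.2) ν)
    (g : Fin N → Fin T → ℝ → ℝ) (hg : ∀ i t, Measurable (g i t)) {a : ℝ}
    (hga : ∀ i t z, |g i t z| ≤ a) (hmean : ∀ i t, ∫ e, g i t (e i t) ∂ν = 0)
    {x : Vec N} {y : Vec T} (hx : ‖x‖ ≤ 2) (hy : ‖y‖ ≤ 2) {b : ℝ} (hb : 0 ≤ b) :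
    ν.real {e | b ≤ ∑ t, ∑ i, g i t (e i t) * x i * y t} ≤ Real.exp (-b ^ 2 / (32 * a ^ 2)) := by
  let X : Fin N × Fin T → (Fin N → Fin T → ℝ) → ℝ := fun q e =>
    (x q.1 * y q.2) * g q.1 q.2 (e q.1 q.2)
  have hX : iIndepFun X ν :=
    hind.comp (fun q z => (x q.1 * y q.2) * g q.1 q.2 z) fun q => (hg q.1 q.2).const_mul _
  let c : Fin N × Fin T → NNReal := fun q => ⟨(x q.1 * y q.2) ^ 2, sq_nonneg _⟩
  have hc : ∀ q, (c q : ℝ) = (x q.1 * y q.2) ^ 2 := fun _ => rfl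
  -- The total variance proxy is at most `a² ‖x‖² ‖y‖² ≤ 16 a²`, because net vectors have norm at
  -- most `2`.
  obtain ⟨K, hK⟩ : ∃ K : NNReal, (K : ℝ) = 16 * a ^ 2 := ⟨⟨16 * a ^ 2, by positivity⟩, rfl⟩
  have hsub : ∀ q, HasSubgaussianMGF (X q) (c q * (‖a - -a‖₊ / 2) ^ 2) ν := fun q =>
    (hasSubgaussianMGF_of_mem_Icc_of_integral_eq_zero
      (((hg q.1 q.2).comp (by fun_prop : Measurable fun e : Fin N → Fin T → ℝ => e q.1 q.2)).aemeasurable)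
      (ae_of_all _ fun e => abs_le.1 (hga q.1 q.2 _)) (hmean q.1 q.2)).const_mul _
  have hsum := HasSubgaussianMGF.sum_of_iIndepFun hX (s := Finset.univ) fun q _ => hsub q
  have hC : ∑ q, c q * (‖a - -a‖₊ / 2) ^ 2 ≤ K := by
    rw [← NNReal.coe_le_coe, hK]
    push_cast
    have h1 : (‖a - -a‖ / 2) ^ 2 = a ^ 2 := by
      rw [Real.norm_eq_abs, div_pow, sq_abs]; ring
    simp only [h1, hc]
    rw [← Finset.sum_mul]
    refine mul_le_mul_of_nonneg_right ?_ (sq_nonneg _)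
    rw [← Finset.univ_product_univ, Finset.sum_product]
    simp only [mul_pow]
    rw [← Finset.sum_mul_sum, ← EuclideanSpace.real_norm_sq_eq, ← EuclideanSpace.real_norm_sq_eq]
    have h2 : ‖x‖ ^ 2 ≤ 4 := by nlinarith [norm_nonneg x]
    have h3 : ‖y‖ ^ 2 ≤ 4 := by nlinarith [norm_nonneg y]
    nlinarith [sq_nonneg ‖x‖, sq_nonneg ‖y‖]
  have hsum' : HasSubgaussianMGF (fun e => ∑ q, X q e) K ν :=
    ⟨hsum.integrable_exp_mul, fun t => (hsum.mgf_le t).trans (by gcongr)⟩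
  have h := hsum'.measure_ge_le hb
  have hset : {e | b ≤ ∑ t, ∑ i, g i t (e i t) * x i * y t} = {e | b ≤ ∑ q, X q e} := by
    ext e
    simp only [Set.mem_ofPred_eq]
    rw [← Finset.univ_product_univ, Finset.sum_product, Finset.sum_comm]
    simp only [X, mul_comm, mul_assoc]
  rw [hset]
  refine h.trans_eq ?_
  congr 2
  rw [hK]
  ring

/-- The union bound over the net: `5 ^ n ≤ exp (2n)`, while the constant `10` makes the Hoeffding
exponent `-(100/32) n ≤ -3n`. -/
lemma card_mul_exp_le {m n : ℕ} (hm : m ≤ 5 ^ n) {a : ℝ} (ha : 0 < a) :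
    (m : ℝ) * Real.exp (-(10 * a * √n) ^ 2 / (32 * a ^ 2)) ≤ Real.exp (-n) := by
  have h5 : (5 : ℝ) ≤ Real.exp 2 := by
    have : (2.7 : ℝ) ≤ Real.exp 1 := by linarith [Real.exp_one_gt_d9]
    rw [show (2 : ℝ) = 1 + 1 by norm_num, Real.exp_add]
    nlinarith
  have h1 : (m : ℝ) ≤ Real.exp (2 * n) := by
    calc (m : ℝ) ≤ (5 : ℝ) ^ n := by exact_mod_cast hm
      _ ≤ Real.exp 2 ^ n := by gcongr
      _ = Real.exp (2 * n) := by rw [← Real.exp_nat_mul, mul_comm]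
  have h2 : -(10 * a * √n) ^ 2 / (32 * a ^ 2) ≤ -3 * n := by
    rw [mul_pow, Real.sq_sqrt (by positivity), div_le_iff₀ (by positivity)]
    nlinarith [mul_nonneg (sq_nonneg a) (Nat.cast_nonneg (α := ℝ) n)]
  calc (m : ℝ) * Real.exp (-(10 * a * √n) ^ 2 / (32 * a ^ 2))
      ≤ Real.exp (2 * n) * Real.exp (-3 * n) := by gcongr
    _ = Real.exp (-n) := by rw [← Real.exp_add]; ring_nf

/-- A matrix whose entries are bounded, centred and independent given `X` has operator norm of
order `√(N + T)`. -/
lemma measure_not_bilinearBound_le {Ω β : Type*} [MeasurableSpace Ω] [MeasurableSpace β]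
    {μ : Measure Ω} [IsProbabilityMeasure μ] {X : Ω → β} (hX : Measurable X)
    {Y : Ω → Fin N → Fin T → ℝ} (hY : Measurable Y)
    (hind : ∀ᵐ x ∂(μ.map X),
      iIndepFun (fun (q : Fin N × Fin T) (e : Fin N → Fin T → ℝ) => e q.1 q.2)
        (condDistrib Y X μ x))
    (G : Fin N → Fin T → β × ℝ → ℝ) (hG : ∀ i t, Measurable (G i t)) {a : ℝ} (ha : 0 < a)
    (hGa : ∀ i t z, |G i t z| ≤ a)
    (hmean : ∀ i t, ∀ᵐ x ∂(μ.map X),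
      ∫ z, G i t (x, z) ∂(condDistrib (fun ω => Y ω i t) X μ x) = 0) :
    μ {ω | ¬ BilinearBound (fun i t => G i t (X ω, Y ω i t)) (10 * a * √((N + T : ℕ) : ℝ))} ≤
      ENNReal.ofReal (Real.exp (-((N + T : ℕ) : ℝ))) := by
  obtain ⟨s, hs5, hs2, hs⟩ := exists_isNorming N
  obtain ⟨u, hu5, hu2, hu⟩ := exists_isNorming T
  set b := 10 * a * √((N + T : ℕ) : ℝ) with hb
  have hb0 : 0 ≤ b := by positivity
  -- The bad event is covered by finitely many measurable sets in the joint space, so that it can be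
  -- disintegrated over `X` without showing that it is itself measurable.
  let E : Vec N × Vec T → Set (β × (Fin N → Fin T → ℝ)) := fun z =>
    {w | b ≤ ∑ t, ∑ i, G i t (w.1, w.2 i t) * z.1 i * z.2 t}
  have hE : ∀ z, MeasurableSet (E z) := by
    intro z
    refine measurableSet_le measurable_const ?_
    refine Finset.measurable_sum _ fun t _ => Finset.measurable_sum _ fun i _ => ?_
    refine ((Measurable.comp (hG i t) ?_).mul_const _).mul_const _
    exact measurable_fst.prodMk (by fun_prop)
  have hbad : MeasurableSet (⋃ z ∈ s ×ˢ u, E z) :=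
    Finset.measurableSet_biUnion _ fun z _ => hE z
  have hsub : {ω | ¬ BilinearBound (fun i t => G i t (X ω, Y ω i t)) b} ⊆
      (fun ω => (X ω, Y ω)) ⁻¹' (⋃ z ∈ s ×ˢ u, E z) := by
    intro ω hω
    by_contra hn
    refine hω (bilinearBound_of_isNorming hs hu hb0 fun x hx y hy => ?_)
    simp only [Set.mem_preimage, Set.mem_iUnion, not_exists] at hn
    exact (not_le.1 (hn (x, y) (Finset.mk_mem_product hx hy))).le
  -- The entrywise conditional law is almost everywhere the marginal of the joint one, which
  -- transfers the centring hypothesis.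
  have hmean' : ∀ i t, ∀ᵐ x ∂(μ.map X), ∫ e, G i t (x, e i t) ∂(condDistrib Y X μ x) = 0 := by
    intro i t
    have hev : Measurable fun e : Fin N → Fin T → ℝ => e i t := by fun_prop
    filter_upwards [hmean i t, condDistrib_comp X (μ := μ) hY.aemeasurable hev] with x h1 h2
    have h3 : condDistrib (fun ω => Y ω i t) X μ x =
        (condDistrib Y X μ x).map fun e => e i t := by
      rw [← Kernel.map_apply _ hev, ← h2]; rfl
    rw [h3, integral_map hev.aemeasurable] at h1
    · exact h1
    · exact ((hG i t).comp measurable_prodMk_left).aestronglyMeasurable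
  have hslice : ∀ᵐ x ∂(μ.map X), condDistrib Y X μ x (Prod.mk x ⁻¹' (⋃ z ∈ s ×ˢ u, E z)) ≤
      ENNReal.ofReal (Real.exp (-((N + T : ℕ) : ℝ))) := by
    filter_upwards [hind, ae_all_iff.2 fun i => ae_all_iff.2 fun t => hmean' i t] with x h1 h2
    have h3 : ∀ z ∈ s ×ˢ u, condDistrib Y X μ x (Prod.mk x ⁻¹' E z) ≤
        ENNReal.ofReal (Real.exp (-b ^ 2 / (32 * a ^ 2))) := by
      intro z hz
      obtain ⟨hz1, hz2⟩ := Finset.mem_product.1 hz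
      have := measure_bilinear_ge_le h1 (fun i t w => G i t (x, w))
        (fun i t => (hG i t).comp measurable_prodMk_left) (fun i t w => hGa i t (x, w)) h2
        (hs2 _ hz1) (hu2 _ hz2) hb0
      rw [← ofReal_measureReal]
      exact ENNReal.ofReal_le_ofReal this
    rw [Set.preimage_iUnion₂]
    refine (measure_biUnion_finset_le _ _).trans ((Finset.sum_le_sum h3).trans ?_)
    rw [Finset.sum_const, nsmul_eq_mul, ← ENNReal.ofReal_natCast,
      ← ENNReal.ofReal_mul (by positivity)]
    refine ENNReal.ofReal_le_ofReal (card_mul_exp_le ?_ ha)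
    rw [Finset.card_product, pow_add]
    exact Nat.mul_le_mul hs5 hu5
  calc _ ≤ μ ((fun ω => (X ω, Y ω)) ⁻¹' (⋃ z ∈ s ×ˢ u, E z)) := measure_mono hsub
    _ = (μ.map fun ω => (X ω, Y ω)) (⋃ z ∈ s ×ˢ u, E z) :=
        (Measure.map_apply (hX.prodMk hY) hbad).symm
    _ = ∫⁻ x, condDistrib Y X μ x (Prod.mk x ⁻¹' (⋃ z ∈ s ×ˢ u, E z)) ∂(μ.map X) := by
        rw [← compProd_map_condDistrib hY.aemeasurable, Measure.compProd_apply hbad]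
    _ ≤ ∫⁻ _, ENNReal.ofReal (Real.exp (-((N + T : ℕ) : ℝ))) ∂(μ.map X) :=
        lintegral_mono_ae hslice
    _ = _ := by
        have := Measure.isProbabilityMeasure_map (μ := μ) hX.aemeasurable
        simp

end Concentration

/-! ### Symmetric densities bounded below. -/

section SymmetricDensity

/-- The reflection `u ↦ -u` turns the integral into its own negative. -/
lemma integral_eq_zero_of_symmetric_density {f g : ℝ → ℝ} (hf : Measurable f)
    (hsymm : ∀ u, f (-u) = f u) (hodd : ∀ u, g (-u) = -g u) :
    ∫ u, g u ∂(volume.withDensity fun u => ENNReal.ofReal (f u)) = 0 := by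
  rw [integral_withDensity_eq_integral_toReal_smul (by fun_prop)
    (ae_of_all _ fun _ => ENNReal.ofReal_lt_top)]
  have h := integral_neg_eq_self (fun u => (ENNReal.ofReal (f u)).toReal • g u) volume
  simp only [hsymm, hodd, smul_neg, integral_neg] at h
  linarith

lemma mul_le_withDensity_Icc {f : ℝ → ℝ} {c τ : ℝ} (hc : 0 ≤ c)
    (hf : ∀ u ∈ Set.Icc (-(τ / 2)) (τ / 2), c ≤ f u)
    [IsFiniteMeasure (volume.withDensity fun u => ENNReal.ofReal (f u))] :
    c * τ ≤ (volume.withDensity fun u => ENNReal.ofReal (f u)).real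
      (Set.Icc (-(τ / 2)) (τ / 2)) := by
  rw [Measure.real, ← ENNReal.ofReal_le_iff_le_toReal (measure_ne_top _ _),
    withDensity_apply _ measurableSet_Icc]
  calc ENNReal.ofReal (c * τ)
      = ∫⁻ _ in Set.Icc (-(τ / 2)) (τ / 2), ENNReal.ofReal c := by
        rw [setLIntegral_const, Real.volume_Icc, ENNReal.ofReal_mul hc]
        congr 2; ring
    _ ≤ _ := setLIntegral_mono' measurableSet_Icc fun u hu =>
        ENNReal.ofReal_le_ofReal (hf u hu)

end SymmetricDensity

/-! ### Convergence of probabilities. -/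

section Probability

lemma tendsto_measure_zero_of_ae_eventually_notMem {Ω ι : Type*} [MeasurableSpace Ω]
    {μ : Measure Ω} [IsFiniteMeasure μ] {l : Filter ι} [l.IsCountablyGenerated] {A : ι → Set Ω}
    (hA : ∀ i, MeasurableSet (A i)) (h : ∀ᵐ ω ∂μ, ∀ᶠ i in l, ω ∉ A i) :
    Tendsto (fun i => μ (A i)) l (𝓝 0) := by
  have := tendsto_measure_of_ae_tendsto_indicator l (μ := μ) MeasurableSet.empty hA
    MeasurableSet.univ (measure_ne_top _ _) (Eventually.of_forall fun _ => Set.subset_univ _)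
    (h.mono fun ω hω => hω.mono fun i hi => by simpa using hi)
  simpa using this

/-- Subadditivity over `A i` and its complement takes the place of additivity, so the events need
not be measurable. -/
lemma tendsto_measure_one_of_compl {Ω ι : Type*} [MeasurableSpace Ω] {μ : Measure Ω}
    [IsProbabilityMeasure μ] {l : Filter ι} {A : ι → Set Ω}
    (h : Tendsto (fun i => μ (A i)ᶜ) l (𝓝 0)) : Tendsto (fun i => μ (A i)) l (𝓝 1) := by
  have h1 : Tendsto (fun i => 1 - μ (A i)ᶜ) l (𝓝 1) := by
    simpa using ENNReal.Tendsto.sub tendsto_const_nhds h (Or.inl ENNReal.one_ne_top)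
  refine tendsto_of_tendsto_of_tendsto_of_le_of_le h1 tendsto_const_nhds (fun i => ?_)
    fun i => prob_le_one
  rw [tsub_le_iff_right, ← measure_univ (μ := μ), ← Set.union_compl_self (A i)]
  exact measure_union_le _ _

lemma tendsto_exp_neg_add : Tendsto
    (fun p : ℕ × ℕ => ENNReal.ofReal (Real.exp (-((p.1 + p.2 : ℕ) : ℝ)))) atTop (𝓝 0) := by
  have h : Tendsto (fun p : ℕ × ℕ => p.1 + p.2) atTop atTop := by
    refine tendsto_atTop_mono (fun p => Nat.le_add_right p.1 p.2) ?_
    rw [← prod_atTop_atTop_eq]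
    exact tendsto_fst
  have h2 := Real.tendsto_exp_neg_atTop_nhds_zero.comp
    ((tendsto_natCast_atTop_atTop (R := ℝ)).comp h)
  simpa using ENNReal.tendsto_ofReal h2

end Probability

/-! ### High-probability events in the factor model. -/

namespace FactorModel

variable {Ω : Type*} [MeasurableSpace Ω] {r : ℕ}

lemma measurable_factors (M : FactorModel Ω r) (N T : ℕ) : Measurable (M.factors N T) :=
  measurable_pi_lambda _ fun t => M.measurable_factor N T t

lemma measurable_errors (M : FactorModel Ω r) (N T : ℕ) : Measurable (M.errors N T) :=
  measurable_pi_lambda _ fun i => measurable_pi_lambda _ fun t => M.measurable_error N T i t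

variable {μ : Measure Ω} [IsProbabilityMeasure μ]

/-- The conditional probability, given the factors, that an error lies in the quadratic zone of the
Huber loss. -/
def centralMass (M : FactorModel Ω r) (μ : Measure Ω) [IsProbabilityMeasure μ] (τ : ℝ) (N T : ℕ)
    (i : Fin N) (t : Fin T) (x : Fin T → Vec r) : ℝ :=
  (M.errorLaw μ N T i t x).real (Set.Icc (-(τ / 2)) (τ / 2))

instance isMarkovKernel_errorLaw (M : FactorModel Ω r) (N T : ℕ) (i : Fin N) (t : Fin T) :
    IsMarkovKernel (M.errorLaw μ N T i t) := by
  unfold errorLaw; infer_instance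

lemma measurable_centralMass (M : FactorModel Ω r) (τ : ℝ) (N T : ℕ) (i : Fin N) (t : Fin T) :
    Measurable (M.centralMass μ τ N T i t) :=
  (Kernel.measurable_coe _ measurableSet_Icc).ennreal_toReal

/-- The density bound on the compact interval of length `τ` is uniform in the panel, hence so is the
curvature constant. -/
lemma exists_le_centralMass {M : FactorModel Ω r} (h : M.RegularErrors μ) {τ : ℝ} (hτ : 0 < τ) :
    ∃ c > 0, ∀ N T, ∀ᵐ ω ∂μ, ∀ i t, c ≤ M.centralMass μ τ N T i t (M.factors N T ω) := by
  obtain ⟨f, hf, hlow⟩ := h.density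
  obtain ⟨c, hc, hcf⟩ := hlow (Set.Icc (-(τ / 2)) (τ / 2)) isCompact_Icc
  refine ⟨c * τ, by positivity, fun N T => ?_⟩
  refine ae_all_iff.2 fun i => ae_all_iff.2 fun t => ?_
  refine ae_of_ae_map (M.measurable_factors N T).aemeasurable
    (p := fun x => c * τ ≤ M.centralMass μ τ N T i t x) ?_
  filter_upwards [hf N T i t, hcf N T i t] with x hx hcx
  unfold centralMass
  rw [hx.1]
  have : IsFiniteMeasure (volume.withDensity fun u => ENNReal.ofReal (f N T i t x u)) := by
    rw [← hx.1]; infer_instance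
  exact mul_le_withDensity_Icc hc.le fun u hu => (hcx u hu).le

/-- The odd function `clip τ` has conditional mean zero under a symmetric density. The slack `τ ≤ a`
lets both noise matrices share one constant. -/
lemma measure_clip_not_bilinearBound_le {M : FactorModel Ω r} (h2 : M.CondIndepErrors μ)
    (h3 : M.RegularErrors μ) {τ a : ℝ} (hτ : 0 < τ) (ha : τ ≤ a) (N T : ℕ) :
    μ {ω | ¬ BilinearBound (fun i t => clip τ (M.error N T i t ω))
      (10 * a * √((N + T : ℕ) : ℝ))} ≤ ENNReal.ofReal (Real.exp (-((N + T : ℕ) : ℝ))) := by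
  obtain ⟨f, hf, -⟩ := h3.density
  refine measure_not_bilinearBound_le (M.measurable_factors N T) (M.measurable_errors N T)
    (h2 N T) (fun _ _ z => clip τ z.2) (fun _ _ => (measurable_clip τ).comp measurable_snd)
    (hτ.trans_le ha) (fun _ _ z => (abs_clip_le hτ z.2).trans ha) fun i t => ?_
  filter_upwards [hf N T i t] with x hx
  change ∫ z, clip τ z ∂(M.errorLaw μ N T i t x) = 0
  rw [hx.1]
  exact integral_eq_zero_of_symmetric_density hx.2.1.measurable hx.2.2 (clip_neg hτ)

lemma measure_central_not_bilinearBound_le {M : FactorModel Ω r} (h2 : M.CondIndepErrors μ)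
    (τ : ℝ) {a : ℝ} (ha : 1 ≤ a) (N T : ℕ) :
    μ {ω | ¬ BilinearBound (fun i t =>
      Set.indicator (Set.Icc (-(τ / 2)) (τ / 2)) 1 (M.error N T i t ω) -
        M.centralMass μ τ N T i t (M.factors N T ω))
      (10 * a * √((N + T : ℕ) : ℝ))} ≤ ENNReal.ofReal (Real.exp (-((N + T : ℕ) : ℝ))) := by
  have hind : Measurable (Set.indicator (Set.Icc (-(τ / 2)) (τ / 2)) (1 : ℝ → ℝ)) :=
    measurable_one.indicator measurableSet_Icc
  refine measure_not_bilinearBound_le (M.measurable_factors N T) (M.measurable_errors N T)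
    (h2 N T) (fun i t z => Set.indicator (Set.Icc (-(τ / 2)) (τ / 2)) 1 z.2 -
        M.centralMass μ τ N T i t z.1)
    (fun i t => (hind.comp measurable_snd).sub
      ((M.measurable_centralMass τ N T i t).comp measurable_fst))
    (zero_lt_one.trans_le ha) (fun i t z => ?_) fun i t => ?_
  · refine le_trans ?_ ha
    have h0 : 0 ≤ M.centralMass μ τ N T i t z.1 := measureReal_nonneg
    have h1 : M.centralMass μ τ N T i t z.1 ≤ 1 := measureReal_le_one
    by_cases hz : z.2 ∈ Set.Icc (-(τ / 2)) (τ / 2)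
    · rw [Set.indicator_of_mem hz, Pi.one_apply, abs_le]; constructor <;> linarith
    · rw [Set.indicator_of_notMem hz, abs_le]; constructor <;> linarith
  · refine ae_of_all _ fun x => ?_
    change ∫ z, Set.indicator (Set.Icc (-(τ / 2)) (τ / 2)) 1 z -
      M.centralMass μ τ N T i t x ∂(M.errorLaw μ N T i t x) = 0
    have hint : Integrable (Set.indicator (Set.Icc (-(τ / 2)) (τ / 2)) (1 : ℝ → ℝ))
        (M.errorLaw μ N T i t x) := (integrable_const (1 : ℝ)).indicator measurableSet_Icc
    rw [integral_sub hint (integrable_const _), integral_indicator_one measurableSet_Icc]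
    simp [centralMass]

/-- Any positive `σ` below the smallest limit works, as almost sure convergence implies convergence
in probability. For `r = 0` the event is empty. -/
lemma exists_tendsto_measure_secondMoment_lt {M : FactorModel Ω r} {𝓛 𝓕 : Set (Vec r)}
    (h : M.StrongFactors μ 𝓛 𝓕) :
    ∃ σ > 0, Tendsto (fun p : ℕ × ℕ =>
      μ {ω | ∃ j, secondMoment (M.factors p.1 p.2 ω) j j < σ}) atTop (𝓝 0) := by
  obtain ⟨σ₀, -, hpos, hlim⟩ := h.limits
  obtain ⟨σ, hσ, hσlt⟩ : ∃ σ > 0, ∀ j, σ < σ₀ j := by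
    rcases isEmpty_or_nonempty (Fin r) with hr | hr
    · exact ⟨1, one_pos, fun j => isEmptyElim j⟩
    · obtain ⟨j₀, hj₀⟩ := Finite.exists_min σ₀
      exact ⟨σ₀ j₀ / 2, half_pos (hpos j₀), fun j => (half_lt_self (hpos j₀)).trans_le (hj₀ j)⟩
  refine ⟨σ, hσ, tendsto_measure_zero_of_ae_eventually_notMem (fun p => ?_) ?_⟩
  · simp only [Set.ofPred_exists]
    refine MeasurableSet.iUnion fun j => measurableSet_lt ?_ measurable_const
    simp only [secondMoment, Matrix.of_apply, factors]
    refine Measurable.div_const (Finset.measurable_sum _ fun t _ => ?_) _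
    have : Measurable fun ω => M.factor p.1 p.2 t ω j := by
      have := M.measurable_factor p.1 p.2 t
      fun_prop
    exact this.mul this
  · filter_upwards [ae_all_iff.2 hlim] with ω hω
    filter_upwards [eventually_all.2 fun j => (hω j).eventually (lt_mem_nhds (hσlt j))] with p hp
    simpa using fun j => (hp j).le

end FactorModel

/-! ### Exact count on the good event, and conclusion. -/

/-- On the event that the truth is well conditioned and the noise matrices have operator norm at
most `g √(N + T)`, the factor count is exact. -/
lemma factorCount_eq_of_bilinearBound {N T r k : ℕ} (hk : r ≤ k) {τ B c g σ P : ℝ} (hτ : 0 < τ)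
    (hB : τ ≤ B) (hc : 0 < c) (hg : 0 ≤ g) (hN : N ≠ 0) (hT : T ≠ 0) {𝓛 𝓕 : Set (Vec k)}
    {𝓛' 𝓕' : Set (Vec r)} (e p : Fin N → Fin T → ℝ) (θ₀ : Param r N T) (θ : Param k N T)
    (hθ₀ : θ₀ ∈ paramSpace 𝓛' 𝓕' N T)
    (hmin : IsHuberMinimizer τ 𝓛 𝓕 (fun i t => common θ₀ i t + e i t) θ)
    (hcl : ∀ η > 0, ∃ θ' ∈ paramSpace 𝓛 𝓕 N T, commonDist θ' (padParam k θ₀) < η)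
    (hDB : ∀ i t, |common θ i t - common θ₀ i t| ≤ B)
    (hp : ∀ i t, c ≤ p i t)
    (hψ : BilinearBound (fun i t => clip τ (e i t)) (g * √((N + T : ℕ) : ℝ)))
    (hξ : BilinearBound
      (fun i t => Set.indicator (Set.Icc (-(τ / 2)) (τ / 2)) 1 (e i t) - p i t)
      (g * √((N + T : ℕ) : ℝ)))
    (hσ : ∀ j, σ ≤ secondMoment θ₀.2 j j)
    (hPlow : 2 * ((√((k + r : ℕ) : ℝ) + τ / 4 * (k + r : ℕ)) / (τ / (4 * B) * c) * g) ^ 2 <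
      P * (min N T : ℕ))
    (hPup : 4 * P < σ) : factorCount P θ = r := by
  have hB0 : 0 < B := hτ.trans_le hB
  have hfro := frobenius_common_sub_le hk hτ hB hc (by positivity) hN hT e p θ₀ θ hmin hcl hDB hp
    hψ hξ
  rw [← mul_assoc] at hfro
  set G := (√((k + r : ℕ) : ℝ) + τ / 4 * (k + r : ℕ)) / (τ / (4 * B) * c) * g with hG
  have hN0 : (0 : ℝ) < N := by positivity
  have hT0 : (0 : ℝ) < T := by positivity
  have hm0 : (0 : ℝ) < (min N T : ℕ) := by
    exact_mod_cast lt_min (Nat.pos_of_ne_zero hN) (Nat.pos_of_ne_zero hT)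
  have hP0 : 0 < P := by
    have : 0 < P * (min N T : ℕ) := lt_of_le_of_lt (by positivity) hPlow
    exact pos_of_mul_pos_left this hm0.le
  set S := ∑ t, ∑ i, (common θ i t - common θ₀ i t) ^ 2 with hS
  have hS2 : S ≤ G ^ 2 * ((N : ℝ) + T) := by
    have hS0 : 0 ≤ S := by positivity
    have := pow_le_pow_left₀ (Real.sqrt_nonneg _) hfro 2
    rw [Real.sq_sqrt hS0, mul_pow, Real.sq_sqrt (by positivity)] at this
    push_cast at this
    exact this
  -- This turns `G² (N + T) / (NT)` into the rate `2 G² / min N T`, the quantity that `P` must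
  -- exceed.
  have hmin' : ((min N T : ℕ) : ℝ) * (N + T) ≤ 2 * (T * N) := by
    have h1 : ((min N T : ℕ) : ℝ) ≤ N := by exact_mod_cast min_le_left N T
    have h2 : ((min N T : ℕ) : ℝ) ≤ T := by exact_mod_cast min_le_right N T
    nlinarith
  have hQ : S / ((T : ℝ) * N) < P := by
    rw [div_lt_iff₀ (by positivity)]
    have h1 : S * (min N T : ℕ) ≤ G ^ 2 * (2 * (T * N)) := by
      calc S * (min N T : ℕ) ≤ G ^ 2 * ((N : ℝ) + T) * (min N T : ℕ) := by gcongr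
        _ = G ^ 2 * ((min N T : ℕ) * ((N : ℝ) + T)) := by ring
        _ ≤ _ := by gcongr
    have h2 : 2 * G ^ 2 * (T * N) < P * (min N T : ℕ) * (T * N) :=
      mul_lt_mul_of_pos_right hPlow (by positivity)
    have h3 : S * (min N T : ℕ) < P * (T * N) * (min N T : ℕ) := by linarith
    exact lt_of_mul_lt_mul_right h3 hm0.le
  obtain ⟨-, -, hL₀, hF₀, -, -⟩ := hθ₀
  obtain ⟨⟨-, -, hL, hF, -, -⟩, -⟩ := hmin
  have hd : √(S / ((T : ℝ) * N)) < √P := Real.sqrt_lt_sqrt (by positivity) hQ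
  refine factorCount_eq_of_close hN hT θ₀ θ hL₀ hF₀ hL hF hP0.le hσ hd ?_
  have h4 : 2 * √P < √σ := by
    rw [Real.lt_sqrt (by positivity), mul_pow, Real.sq_sqrt hP0.le]
    linarith
  linarith

end HuberFactor

end

open HuberFactor in
theorem theorem3p3 {Ω : Type*} [MeasurableSpace Ω] (μ : Measure Ω) [IsProbabilityMeasure μ]
    (r k : ℕ) (hk : r < k) (τ : ℝ) (hτ : 0 < τ)
    (M : FactorModel Ω r)
    (𝓛r 𝓕r : Set (Vec r)) (𝓛k 𝓕k : Set (Vec k))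
    (h1 : M.StrongFactors μ 𝓛r 𝓕r)
    (h2 : M.CondIndepErrors μ)
    (h3 : M.RegularErrors μ)
    (h𝓛k : IsCompact 𝓛k) (h𝓕k : IsCompact 𝓕k)
    -- the zero-padded true loadings and factors lie in the sets of the overfitted model
    (hpad : ∀ᶠ p : ℕ × ℕ in atTop, ∀ᵐ ω ∂μ,
      (∀ i, padVec k (M.loading p.1 p.2 i) ∈ 𝓛k) ∧
      (∀ t, padVec k (M.factor p.1 p.2 t ω) ∈ 𝓕k))
    -- the zero-padded truth is a limit of normalized parameters, in the pseudo-distance between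
    -- common components
    (hclosure : ∀ᶠ p : ℕ × ℕ in atTop, ∀ᵐ ω ∂μ, ∀ η > 0,
      ∃ θ ∈ paramSpace 𝓛k 𝓕k p.1 p.2,
        commonDist θ (padParam k (M.trueParam p.1 p.2 ω)) < η)
    (θhat : ∀ N T : ℕ, Ω → Param k N T)
    (hmeas : ∀ N T, Measurable (θhat N T))
    (hmin : Tendsto (fun p : ℕ × ℕ =>
        μ {ω | ¬ IsHuberMinimizer τ 𝓛k 𝓕k (M.obs p.1 p.2 ω) (θhat p.1 p.2 ω)})
      atTop (𝓝 0))
    (P : ℕ → ℕ → ℝ)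
    (hP0 : Tendsto (fun p : ℕ × ℕ => P p.1 p.2) atTop (𝓝 0))
    (hPL : Tendsto (fun p : ℕ × ℕ => P p.1 p.2 * (min p.1 p.2 : ℕ)) atTop atTop) :
    Tendsto (fun p : ℕ × ℕ => μ {ω | factorCount (P p.1 p.2) (θhat p.1 p.2 ω) = r})
      atTop (𝓝 1) := by
  obtain ⟨σ, hσ, hσlim⟩ := FactorModel.exists_tendsto_measure_secondMoment_lt h1
  obtain ⟨c, hc, hcmass⟩ := FactorModel.exists_le_centralMass h3 hτ
  obtain ⟨b₁, hb₁⟩ := h1.compact_loadings.isBounded.exists_norm_le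
  obtain ⟨b₂, hb₂⟩ := h1.compact_factors.isBounded.exists_norm_le
  obtain ⟨b₃, hb₃⟩ := h𝓛k.isBounded.exists_norm_le
  obtain ⟨b₄, hb₄⟩ := h𝓕k.isBounded.exists_norm_le
  -- `B` bounds the difference of common components by compactness; the summand `τ` secures `τ ≤ B`.
  set B := τ + |b₁ * b₂| + |b₃ * b₄| with hB
  have hτB : τ ≤ B := by rw [hB]; linarith [abs_nonneg (b₁ * b₂), abs_nonneg (b₃ * b₄)]
  -- `τ + 1` dominates both entry bounds: `τ` for the clipped errors and `1` for the centred
  -- indicator.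
  set g := 10 * (τ + 1) with hg
  have hlim := ((hmin.add hσlim).add tendsto_exp_neg_add).add tendsto_exp_neg_add
  simp only [add_zero] at hlim
  refine tendsto_measure_one_of_compl
    (tendsto_of_tendsto_of_tendsto_of_le_of_le' tendsto_const_nhds hlim
      (Eventually.of_forall fun _ => zero_le) ?_)
  have hpos : ∀ᶠ p : ℕ × ℕ in atTop, p.1 ≠ 0 ∧ p.2 ≠ 0 := by
    filter_upwards [eventually_ge_atTop ((1, 1) : ℕ × ℕ)] with p hp
    have := Prod.le_def.1 hp
    simp only at this
    omega
  filter_upwards [h1.true_mem, hclosure, hpos, hPL.eventually_gt_atTop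
      (2 * ((√((k + r : ℕ) : ℝ) + τ / 4 * (k + r : ℕ)) / (τ / (4 * B) * c) * g) ^ 2),
    hP0.eventually (gt_mem_nhds (by positivity : (0 : ℝ) < σ / 4))]
    with ⟨N, T⟩ htrue hcl ⟨hN, hT⟩ hPlow hPup
  dsimp only at *
  refine le_trans ?_ (add_le_add (add_le_add le_rfl
    (FactorModel.measure_clip_not_bilinearBound_le h2 h3 hτ (by linarith : τ ≤ τ + 1) N T))
    (FactorModel.measure_central_not_bilinearBound_le h2 τ (by linarith : 1 ≤ τ + 1) N T))
  -- Up to null sets, a wrong count forces one of four bad events: no minimizer, a small true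
  -- eigenvalue, or a large operator norm of either noise matrix.
  refine le_trans (measure_mono_ae ?_) ((measure_union_le _ _).trans (add_le_add
    ((measure_union_le _ _).trans (add_le_add (measure_union_le _ _) le_rfl)) le_rfl))
  filter_upwards [htrue, hcl, hcmass N T] with ω hω hclω hmass hne
  by_contra hgood
  change ω ∉ (_ : Set Ω) at hgood
  simp only [Set.mem_union, Set.mem_ofPred_eq, not_or, not_not, not_exists, not_lt] at hgood
  obtain ⟨⟨⟨hm, hs⟩, hψ⟩, hξ⟩ := hgood
  refine hne (factorCount_eq_of_bilinearBound hk.le hτ hτB hc (by positivity) hN hT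
    (fun i t => M.error N T i t ω) _ (M.trueParam N T ω) (θhat N T ω) hω hm hclω (fun i t => ?_)
    hmass hψ hξ hs hPlow (by linarith))
  have g1 := abs_common_le hb₁ hb₂ hω i t
  have g2 := abs_common_le hb₃ hb₄ hm.1 i t
  calc |common (θhat N T ω) i t - common (M.trueParam N T ω) i t|
      ≤ |common (θhat N T ω) i t| + |common (M.trueParam N T ω) i t| := abs_sub _ _
    _ ≤ B := by
      rw [hB]; linarith [le_abs_self (b₁ * b₂), le_abs_self (b₃ * b₄)]
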